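/- Let $q\ge 0$ be an integer. Consider the ergodic layered erasure one-sided interference channel: in channel use $t=0,1,2,\dots$ transmitters $1,2$ send $X_1(t),X_2(t)\in\mathbb F_2^q$ (level $1$ being the most significant bit), and the receivers obtain $$Y_1(t)=S^{\,q-N_{11}(t)}X_1(t),\qquad Y_2(t)=S^{\,q-N_{21}(t)}X_1(t)\oplus S^{\,q-N_{22}(t)}X_2(t),$$ where $S^{d}$ is the $q\times q$ matrix over $\mathbb F_2$ shifting a vector down by $d$ places, so that a link in state $N$ delivers exactly the $N$ most significant bits of its input, as the $N$ least significant bits of its output. The state process $(N_{11}(t),N_{21}(t),N_{22}(t))_{t\ge 0}$ is stationary and ergodic (for instance i.i.d.), independent of the messages, and takes values in $\{0,\dots,q\}^3$ almost surely; its components may be arbitrarily dependent. Write $(N_{11},N_{21},N_{22})$ for the states in one channel use. The transmitters do not know the states; receiver $1$ knows $N_{11}(t)$, and receiver $2$ knows $N_{21}(t)$ and $N_{22}(t)$. A pair $(R_1,R_2)$ of non-negative reals (in bits per channel use) is achievable if for every $\varepsilon>0$ and all sufficiently large $m$ there is a block code of length $m$ with at least $2^{m(R_k-\varepsilon)}$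 messages for user $k=1,2$, for which the probability that some receiver decodes its message wrongly is at most $\varepsilon$, the messages being independent and uniformly distributed. Then there is an achievable pair $(R_1,R_2)$ with $$R_1+R_2=\mathbb E[N_{22}]+\sum_{n=1}^{q}\bigl(\Pr(N_{11}\ge n)-\Pr(N_{21}\ge n,\ N_{21}-N_{22}<n)\bigr)^+,\qquad x^+=\max(x,0).$$ Moreover this pair is achievable with codes in which user $1$ sends the bit $0$ in every channel use on every level $n$ that does not satisfy $$\Pr(N_{11}\ge n)>\Pr(N_{21}\ge n,\ N_{21}-N_{22}<n).$$ -/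

import Mathlib

open MeasureTheory Filter
open scoped Matrix

namespace LayeredErasure

/-- A channel input or output symbol: `q` bits. Coordinate `i : Fin q` is level `i + 1`;
coordinate `0` is the most significant bit. -/
abbrev Word (q : ℕ) : Type := Fin q → ZMod 2

/-- The `q × q` down-shift by `d` places over `𝔽₂`: the entry in row `i`, column `j` is `1`
exactly when `i = j + d`. -/
def shiftMatrix (q d : ℕ) : Matrix (Fin q) (Fin q) (ZMod 2) :=
  Matrix.of fun i j => if (i : ℕ) = (j : ℕ) + d then 1 else 0

/-- A `q`-bit layered erasure link in state `N`: the `N` most significant bits of the input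
come out as the `N` least significant bits of the output. -/
def link {q : ℕ} (N : ℕ) (x : Word q) : Word q :=
  shiftMatrix q (q - N) *ᵥ x

/-- An ergodic layered erasure one-sided interference channel (`N₁₂ = 0`) over the probability
space `(Ω, μ)`. In channel use `t` the fading states are `N11 t`, `N21 t`, `N22 t`; they may be
arbitrarily dependent on each other. The state process is stationary and ergodic, that is, the
time shift is ergodic (in particular measure preserving) for the law of the process. -/
structure OneSidedIFC (q : ℕ) {Ω : Type*} [MeasurableSpace Ω] (μ : Measure Ω) where
  N11 : ℕ → Ω → ℕ
  N21 : ℕ → Ω → ℕ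
  N22 : ℕ → Ω → ℕ
  measurable_N11 : ∀ t, Measurable (N11 t)
  measurable_N21 : ∀ t, Measurable (N21 t)
  measurable_N22 : ∀ t, Measurable (N22 t)
  N11_le : ∀ t, ∀ᵐ ω ∂μ, N11 t ω ≤ q
  N21_le : ∀ t, ∀ᵐ ω ∂μ, N21 t ω ≤ q
  N22_le : ∀ t, ∀ᵐ ω ∂μ, N22 t ω ≤ q
  ergodic : Ergodic (fun (s : ℕ → ℕ × ℕ × ℕ) (t : ℕ) => s (t + 1))
    (μ.map fun ω t => (N11 t ω, N21 t ω, N22 t ω))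

/-- A block code of length `n`. The encoders know only their own message (no channel state
information, no feedback). Receiver `1` decodes from its received block and the states of its
only incoming link; receiver `2` decodes from its received block and the states of its two
incoming links (first those from transmitter `1`, then those from transmitter `2`). -/
structure Code (q n : ℕ) where
  M₁ : ℕ
  M₂ : ℕ
  enc₁ : Fin M₁ → Fin n → Word q
  enc₂ : Fin M₂ → Fin n → Word q
  dec₁ : (Fin n → Word q) → (Fin n → ℕ) → Fin M₁
  dec₂ : (Fin n → Word q) → (Fin n → ℕ) → (Fin n → ℕ) → Fin M₂

/-- User `1` never transmits on a level outside `L`. -/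
def Code.UsesOnly₁ {q n : ℕ} (C : Code q n) (L : Set (Fin q)) : Prop :=
  ∀ w t, ∀ i ∉ L, C.enc₁ w t i = 0

namespace OneSidedIFC

variable {q : ℕ} {Ω : Type*} [MeasurableSpace Ω] {μ : Measure Ω}

/-- The block received by receiver `1` when transmitter `1` sends `x₁`. -/
def out₁ (ch : OneSidedIFC q μ) {n : ℕ} (x₁ : Fin n → Word q) (ω : Ω) : Fin n → Word q :=
  fun t => link (ch.N11 t ω) (x₁ t)

/-- The block received by receiver `2` when the transmitters send `x₁` and `x₂`. -/
def out₂ (ch : OneSidedIFC q μ) {n : ℕ} (x₁ x₂ : Fin n → Word q) (ω : Ω) : Fin n → Word q :=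
  fun t => link (ch.N21 t ω) (x₁ t) + link (ch.N22 t ω) (x₂ t)

/-- The event that at least one receiver decodes its message wrongly, when the messages are
`w₁` and `w₂`. -/
def errorEvent (ch : OneSidedIFC q μ) {n : ℕ} (C : Code q n) (w₁ : Fin C.M₁) (w₂ : Fin C.M₂) :
    Set Ω :=
  {ω | C.dec₁ (ch.out₁ (C.enc₁ w₁) ω) (fun t => ch.N11 t ω) ≠ w₁ ∨
    C.dec₂ (ch.out₂ (C.enc₁ w₁) (C.enc₂ w₂) ω)
      (fun t => ch.N21 t ω) (fun t => ch.N22 t ω) ≠ w₂}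

/-- The error probability, for messages that are independent of each other and of the channel
states, and uniformly distributed. -/
noncomputable def errorProb (ch : OneSidedIFC q μ) {n : ℕ} (C : Code q n) : ℝ :=
  (∑ w₁, ∑ w₂, μ.real (ch.errorEvent C w₁ w₂)) / ((C.M₁ : ℝ) * C.M₂)

/-- The rate pair `(R₁, R₂)` (in bits per channel use) is achievable with codes from the
family `F`: the rates are non-negative and for every `ε > 0`, for all large block lengths
there is a code in `F` with rates at least `R₁ - ε`, `R₂ - ε` and error probability at
most `ε`. -/
def AchievableBy (ch : OneSidedIFC q μ) (F : ∀ n, Set (Code q n)) (R₁ R₂ : ℝ) : Prop :=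
  0 ≤ R₁ ∧ 0 ≤ R₂ ∧ ∀ ε > 0, ∀ᶠ n : ℕ in atTop, ∃ C ∈ F n,
    (2 : ℝ) ^ ((n : ℝ) * (R₁ - ε)) ≤ C.M₁ ∧ (2 : ℝ) ^ ((n : ℝ) * (R₂ - ε)) ≤ C.M₂ ∧
      ch.errorProb C ≤ ε

/-- The rate pair `(R₁, R₂)` is achievable. -/
def Achievable (ch : OneSidedIFC q μ) (R₁ R₂ : ℝ) : Prop :=
  ch.AchievableBy (fun _ => Set.univ) R₁ R₂

/-- `Pr(N₁₁ ≥ n)`: level `n` of transmitter `1` reaches receiver `1`. -/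
noncomputable def prDirect (ch : OneSidedIFC q μ) (n : ℕ) : ℝ :=
  μ.real {ω | n ≤ ch.N11 0 ω}

/-- `Pr(N₂₁ ≥ n, N₂₁ - N₂₂ < n)`: level `n` of transmitter `1` hits a level of transmitter `2`
at receiver `2`. -/
noncomputable def prInterfere (ch : OneSidedIFC q μ) (n : ℕ) : ℝ :=
  μ.real {ω | n ≤ ch.N21 0 ω ∧ (ch.N21 0 ω : ℤ) - ch.N22 0 ω < n}

/-- The levels of transmitter `1` that are more likely to reach receiver `1` than to interfere
at receiver `2`. -/
def goodLevels (ch : OneSidedIFC q μ) : Set (Fin q) :=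
  {i | ch.prInterfere (i + 1) < ch.prDirect (i + 1)}

end OneSidedIFC

end LayeredErasure

/-!
User 1 transmits on the good levels `L` only, and receiver 2 treats user 1 as noise. Both users
draw the bits of their codewords independently and uniformly; the bits of user 1 outside `L` are
then set to zero.

With this choice each receiver faces a plain erasure channel. Receiver 1 sees the bits on the
levels of `L` that reach it (`directLevels`). At receiver 2 a bit of user 2 is useful when it
arrives and no level of `L` lands on the same output level (`cleanLevels`); such a bit is seen
without disturbance, whatever user 1 sends, so the two codebooks can be chosen independently of each
other.

* For an erasure channel, a random codebook with `M` messages has, on average, an error probability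
  of at most `M / 2 ^ k` plus the probability that fewer than `k` bits are received. This is a union
  bound over the competing messages (`exists_codebook`), since two given random codewords agree on a
  set `a` of positions with probability `2 ^ (-|a|)` (`card_collision`).
* The number of bits received in `n` channel uses is a Birkhoff sum of the state process. By the
  mean ergodic theorem, divided by `n` it converges in measure to its expectation
  (`tendstoInMeasure_birkhoffAverage`). Hence every rate below the expected number of bits received
  per channel use is achieved (`eventually_exists_codebook_of_rate`).
* By linearity of expectation the two rates are `∑ n ∈ L, Pr(N₁₁ ≥ n)` and
  `E[N₂₂] - ∑ n ∈ L, Pr(N₂₁ ≥ n, N₂₁ - N₂₂ < n)`: the levels of user 2 that are lost correspond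
  one to one to the levels of `L` that interfere (`card_cleanLevels`). For the good levels `L` the
  difference of the two sums over `L` is the sum of the positive parts.
-/

namespace LayeredErasure

/-! ### Mean ergodic theorem in measure -/

/-- The time averages of a square integrable function along an ergodic map converge in measure to
its integral. -/
theorem tendstoInMeasure_birkhoffAverage {α : Type*} [MeasurableSpace α] {μ : Measure α}
    [IsProbabilityMeasure μ] {T : α → α} (hT : Ergodic T μ) {f : α → ℝ} (hf : MemLp f 2 μ) :
    TendstoInMeasure μ (fun n => birkhoffAverage ℝ T f n) atTop (fun _ => ∫ x, f x ∂μ) := by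
  -- The Koopman operator `g ↦ g ∘ T` on `L²`. Its averages converge to the projection onto its
  -- fixed space, which consists of constants by ergodicity.
  set U : Lp ℝ 2 μ →ₗᵢ[ℝ] Lp ℝ 2 μ :=
    Lp.compMeasurePreservingₗᵢ ℝ T hT.toMeasurePreserving
  have hUapp : ∀ g : Lp ℝ 2 μ, U g = Lp.compMeasurePreserving T hT.toMeasurePreserving g :=
    fun g => rfl
  set K := (U.toContinuousLinearMap.eqLocus (1 : Lp ℝ 2 μ →L[ℝ] Lp ℝ 2 μ)) with hK
  have hlim := U.toContinuousLinearMap.tendsto_birkhoffAverage_orthogonalProjection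
    U.norm_toContinuousLinearMap_le (hf.toLp f)
  set g : Lp ℝ 2 μ := (K.orthogonalProjectionOnto (hf.toLp f) : Lp ℝ 2 μ)
  have hgK : g ∈ K := Submodule.coe_mem _
  have hgfix : U g = g := by simpa [hK, LinearMap.mem_eqLocus] using hgK
  obtain ⟨c, hc⟩ := hT.ae_eq_const_of_ae_eq_comp_ae (Lp.aestronglyMeasurable g)
    ((Lp.coeFn_compMeasurePreserving g hT.toMeasurePreserving).symm.trans
      (by rw [← hUapp, hgfix]))
  -- The constant `c` is found by pairing with `1`, which is a fixed point, hence
  -- orthogonal to `f - g`.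
  set e : Lp ℝ 2 μ := (memLp_const (1 : ℝ)).toLp (fun _ : α => (1 : ℝ)) with he
  have heK : e ∈ K := by
    have : U e = e := by
      rw [hUapp, he, Lp.toLp_compMeasurePreserving]
      rfl
    simpa [hK, LinearMap.mem_eqLocus] using this
  have horth : inner ℝ e (hf.toLp f - g) = 0 := by
    exact Submodule.inner_right_of_mem_orthogonal heK
      (Submodule.sub_starProjection_mem_orthogonal (K := K) (hf.toLp f))
  have hce : c = ∫ x, f x ∂μ := by
    rw [inner_sub_right, sub_eq_zero, L2.inner_def, L2.inner_def] at horth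
    have h1 : ∫ x, inner ℝ (e x) (hf.toLp f x) ∂μ = ∫ x, f x ∂μ := by
      refine integral_congr_ae ?_
      filter_upwards [(memLp_const (1 : ℝ)).coeFn_toLp (p := 2) (μ := μ),
        hf.coeFn_toLp] with x hx hx'
      rw [he, hx, hx']; simp
    have h2 : ∫ x, inner ℝ (e x) (g x) ∂μ = c := by
      have : ∫ x, inner ℝ (e x) (g x) ∂μ = ∫ _, c ∂μ := by
        refine integral_congr_ae ?_
        filter_upwards [(memLp_const (1 : ℝ)).coeFn_toLp (p := 2) (μ := μ), hc] with x hx hx'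
        rw [he, hx, hx']; simp
      simpa using this
    rw [h1, h2] at horth
    exact horth.symm
  have hmeas := tendstoInMeasure_of_tendsto_Lp hlim
  have hiter : ∀ n, (U.toContinuousLinearMap)^[n] (hf.toLp f)
      = (hf.comp_measurePreserving (hT.toMeasurePreserving.iterate n)).toLp (f ∘ T^[n]) := by
    intro n
    induction n with
    | zero => rfl
    | succ n ih =>
      rw [Function.iterate_succ_apply', ih]
      change U _ = _
      rw [hUapp, Lp.toLp_compMeasurePreserving]
      rfl
  refine hmeas.congr (fun n => ?_) (by rw [← hce]; exact hc)
  have hall : ∀ᵐ x ∂μ, ∀ k, ((U.toContinuousLinearMap)^[k] (hf.toLp f) : Lp ℝ 2 μ) x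
      = f (T^[k] x) := by
    rw [ae_all_iff]
    intro k
    rw [hiter]
    exact MemLp.coeFn_toLp _
  have hb : birkhoffAverage ℝ U.toContinuousLinearMap _root_.id n (hf.toLp f)
      = (n : ℝ)⁻¹ • ∑ k ∈ Finset.range n, (U.toContinuousLinearMap)^[k] (hf.toLp f) := rfl
  rw [hb]
  filter_upwards [hall, Lp.coeFn_smul (n : ℝ)⁻¹
    (∑ k ∈ Finset.range n, (U.toContinuousLinearMap)^[k] (hf.toLp f)),
    Lp.coeFn_finsetSum (Finset.range n) (fun k => (U.toContinuousLinearMap)^[k] (hf.toLp f))]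
    with x h1 h2 h3
  rw [h2, Pi.smul_apply, h3]
  simp only [birkhoffAverage, birkhoffSum, Finset.sum_apply, h1]

/-! ### Random codes for erasure channels -/

/-- Two given codewords of a uniformly random codebook agree on `a` with probability
`2 ^ (-|a|)`. -/
theorem card_collision {W ι : Type*} [Fintype W] [DecidableEq W] [Fintype ι] [DecidableEq ι]
    (a : Finset ι) {w w' : W} (h : w ≠ w') :
    (Finset.univ.filter fun c : W → ι → ZMod 2 => ∀ i ∈ a, c w i = c w' i).card * 2 ^ a.card
      = Fintype.card (W → ι → ZMod 2) := by
  -- The codebooks in question form the kernel of a surjective homomorphism onto `a → ZMod 2`.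
  let f : (W → ι → ZMod 2) →+ (a → ZMod 2) :=
    { toFun := fun c i => c w i - c w' i
      map_zero' := by ext; simp
      map_add' := fun c d => by ext; simp; ring }
  have hf : Function.Surjective f := by
    intro u
    refine ⟨Pi.single w fun i => if hi : i ∈ a then u ⟨i, hi⟩ else 0, ?_⟩
    ext i
    simp [f, h.symm]
  have h1 := f.ker.card_mul_index
  rw [AddSubgroup.index_ker, AddMonoidHom.range_eq_top.2 hf] at h1
  have h2 : Nat.card f.ker
      = (Finset.univ.filter fun c : W → ι → ZMod 2 => ∀ i ∈ a, c w i = c w' i).card := by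
    rw [← Fintype.card_subtype, ← Nat.card_eq_fintype_card]
    refine Nat.card_congr (Equiv.subtypeEquivRight fun c => ?_)
    simp [f, AddMonoidHom.mem_ker, funext_iff, sub_eq_zero]
  rw [h2] at h1
  simpa [Nat.card_eq_fintype_card] using h1

/-- Random coding bound for an erasure channel with `A ω` the set of positions received. The event
for message `w` is that some other codeword agrees with that of `w` on all of these positions. -/
theorem exists_codebook {Ω ι : Type*} [MeasurableSpace Ω] (μ : Measure Ω) [IsProbabilityMeasure μ]
    [Fintype ι] (A : Ω → Finset ι) (hA : ∀ a, MeasurableSet (A ⁻¹' {a})) (M k : ℕ) :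
    ∃ c : Fin M → ι → ZMod 2,
      ∑ w, μ.real {ω | ∃ w', w' ≠ w ∧ ∀ i ∈ A ω, c w i = c w' i}
        ≤ M * (μ.real {ω | (A ω).card < k} + M / 2 ^ k) := by
  classical
  -- `p` is the distribution of the set of received positions.
  set p : Finset ι → ℝ := fun a => μ.real (A ⁻¹' {a})
  have hp0 : ∀ a, 0 ≤ p a := fun a => measureReal_nonneg
  have hp1 : ∑ a, p a = 1 := by
    simpa using sum_measureReal_preimage_singleton (μ := μ) (f := A) Finset.univ (fun a _ => hA a)
  set b := μ.real {ω | (A ω).card < k}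
  set S : Finset (Finset ι) := Finset.univ.filter fun a => k ≤ a.card
  let I : (Fin M → ι → ZMod 2) → Fin M → Fin M → Finset ι → ℝ := fun c w w' a =>
    if w' ≠ w ∧ ∀ i ∈ a, c w i = c w' i then 1 else 0
  have hpt : ∀ (c : Fin M → ι → ZMod 2) w,
      μ.real {ω | ∃ w', w' ≠ w ∧ ∀ i ∈ A ω, c w i = c w' i}
        ≤ b + ∑ a ∈ S, p a * ∑ w', I c w w' a := by
    intro c w
    set S' : Finset (Finset ι) := S.filter fun a => ∃ w', w' ≠ w ∧ ∀ i ∈ a, c w i = c w' i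
    have hsub : {ω | ∃ w', w' ≠ w ∧ ∀ i ∈ A ω, c w i = c w' i}
        ⊆ {ω | (A ω).card < k} ∪ ⋃ a ∈ S', A ⁻¹' {a} := by
      intro ω hω
      by_cases hk : (A ω).card < k
      · exact Or.inl hk
      · refine Or.inr ?_
        simp only [Set.mem_iUnion]
        exact ⟨A ω, by simpa [S', S, not_lt.1 hk] using hω, rfl⟩
    refine (measureReal_mono hsub).trans ((measureReal_union_le _ _).trans ?_)
    gcongr
    refine (measureReal_biUnion_finset_le _ _).trans ?_
    rw [Finset.sum_filter]
    refine Finset.sum_le_sum fun a _ => ?_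
    split_ifs with hcol
    · obtain ⟨w', hw'⟩ := hcol
      have : (1 : ℝ) ≤ ∑ w', I c w w' a := by
        have h1 : I c w w' a = 1 := if_pos hw'
        rw [← h1]
        exact Finset.single_le_sum (f := fun w' => I c w w' a)
          (fun x _ => by dsimp only [I]; split_ifs <;> norm_num) (Finset.mem_univ w')
      exact le_mul_of_one_le_right (hp0 a) this
    · exact mul_nonneg (hp0 a) (Finset.sum_nonneg fun x _ => by
        dsimp only [I]; split_ifs <;> norm_num)
  -- Summing over all codebooks; `Q` is their number.
  set Q : ℝ := (Fintype.card (Fin M → ι → ZMod 2) : ℝ) with hQ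
  have hI : ∀ w w' a, a ∈ S → ∑ c, I c w w' a ≤ Q / 2 ^ k := by
    intro w w' a ha
    have hk : k ≤ a.card := by simpa [S] using ha
    by_cases hw : w' = w
    · simp only [I, hw, ne_eq, not_true_eq_false, false_and, if_false, Finset.sum_const_zero]
      positivity
    · have hcount := card_collision (ι := ι) a (Ne.symm hw)
      have hcount' : (((Finset.univ.filter fun c : Fin M → ι → ZMod 2 =>
          ∀ i ∈ a, c w i = c w' i).card : ℕ) : ℝ) * 2 ^ a.card = Q := by
        rw [hQ, ← hcount]; push_cast; rfl
      simp only [I, ne_eq, hw, not_false_eq_true, true_and, Finset.sum_boole]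
      rw [le_div_iff₀ (by positivity), ← hcount']
      gcongr
      norm_num
  have htot : ∑ c : Fin M → ι → ZMod 2,
      ∑ w, μ.real {ω | ∃ w', w' ≠ w ∧ ∀ i ∈ A ω, c w i = c w' i}
        ≤ ∑ _c : Fin M → ι → ZMod 2, M * (b + M / 2 ^ k) := by
    calc _ ≤ ∑ c : Fin M → ι → ZMod 2, ∑ w, (b + ∑ a ∈ S, p a * ∑ w', I c w w' a) :=
          Finset.sum_le_sum fun c _ => Finset.sum_le_sum fun w _ => hpt c w
      _ = Q * (M * b) + ∑ w, ∑ a ∈ S, p a * ∑ w', ∑ c, I c w w' a := by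
          simp only [Finset.sum_add_distrib, Finset.sum_const, Finset.card_univ, Fintype.card_fin,
            nsmul_eq_mul, ← hQ]
          congr 1
          rw [Finset.sum_comm]
          refine Finset.sum_congr rfl fun w _ => ?_
          rw [Finset.sum_comm]
          refine Finset.sum_congr rfl fun a _ => ?_
          rw [← Finset.mul_sum, Finset.sum_comm]
      _ ≤ Q * (M * b) + ∑ w : Fin M, ∑ a ∈ S, p a * ∑ w' : Fin M, Q / 2 ^ k := by
          gcongr with w _ a ha w'
          exact hI w w' a ha
      _ ≤ Q * (M * b) + ∑ w : Fin M, 1 * ∑ w' : Fin M, Q / 2 ^ k := by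
          gcongr with w
          rw [← Finset.sum_mul]
          gcongr
          rw [← hp1]
          exact Finset.sum_le_univ_sum_of_nonneg hp0
      _ = _ := by
          simp only [Finset.sum_const, Finset.card_univ, Fintype.card_fin, nsmul_eq_mul, ← hQ]
          ring
  obtain ⟨c, -, hc⟩ := Finset.exists_le_of_sum_le Finset.univ_nonempty htot
  exact ⟨c, hc⟩


/-- If with high probability nearly `n * R` positions are received, then there are codebooks of rate
`R - ε` with small average error probability. -/
theorem eventually_exists_codebook_of_rate {Ω : Type*} [MeasurableSpace Ω] (μ : Measure Ω)
    [IsProbabilityMeasure μ] {ι : ℕ → Type*} [∀ n, Fintype (ι n)] (A : ∀ n, Ω → Finset (ι n))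
    (hA : ∀ n a, MeasurableSet (A n ⁻¹' {a})) {R : ℝ}
    (hR : ∀ δ > 0, Tendsto (fun n : ℕ => μ.real {ω | ((A n ω).card : ℝ) < n * (R - δ)}) atTop
      (nhds 0)) {ε : ℝ} (hε : 0 < ε) :
    ∀ᶠ n : ℕ in atTop, ∃ M : ℕ, 0 < M ∧ (2 : ℝ) ^ ((n : ℝ) * (R - ε)) ≤ M ∧
      ∃ c : Fin M → ι n → ZMod 2,
        (∑ w, μ.real {ω | ∃ w', w' ≠ w ∧ ∀ i ∈ A n ω, c w i = c w' i}) / M ≤ ε := by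
  -- At non-positive rate `R - ε` a single message suffices. This case is separate since rounding
  -- `2 ^ (n * (R - ε))` up to an integer may then increase it by more than a factor of `2`.
  rcases le_or_gt R ε with hRε | hRε
  · refine Eventually.of_forall fun n => ⟨1, one_pos, ?_, fun _ _ => 0, ?_⟩
    · rw [Nat.cast_one]
      exact Real.rpow_le_one_of_one_le_of_nonpos one_le_two
        (mul_nonpos_of_nonneg_of_nonpos n.cast_nonneg (by linarith))
    · have : ∀ w w' : Fin 1, ¬ w' ≠ w := fun w w' h => h (Subsingleton.elim _ _)
      simp [this, hε.le]
  have hexp : Tendsto (fun n : ℕ => (2 : ℝ) * ((2 : ℝ) ^ (-(ε / 2))) ^ n) atTop (nhds 0) := by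
    simpa using (tendsto_pow_atTop_nhds_zero_of_lt_one (by positivity)
      (Real.rpow_lt_one_of_one_lt_of_neg one_lt_two (by linarith : -(ε / 2) < 0))).const_mul 2
  have hlim := (hR (ε / 2) (by positivity)).add hexp
  rw [add_zero] at hlim
  filter_upwards [hlim.eventually (eventually_le_nhds hε)] with n hn
  set x : ℝ := (2 : ℝ) ^ ((n : ℝ) * (R - ε)) with hx
  have hx1 : 1 ≤ x := Real.one_le_rpow one_le_two (mul_nonneg n.cast_nonneg (by linarith))
  set M := ⌈x⌉₊
  -- The rate `R - ε` and the typical number `n * (R - ε / 2)` of positions leave a gap of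
  -- `n * ε / 2`.
  set k := ⌈(n : ℝ) * (R - ε / 2)⌉₊
  have hM : 0 < M := Nat.ceil_pos.2 (by linarith)
  have hM' : (0 : ℝ) < M := by exact_mod_cast hM
  have hMx : (M : ℝ) ≤ 2 * x := by
    have := (Nat.ceil_lt_add_one (by linarith : 0 ≤ x)).le
    linarith
  obtain ⟨c, hc⟩ := exists_codebook μ (A n) (hA n) M k
  refine ⟨M, hM, Nat.le_ceil x, c, ?_⟩
  rw [div_le_iff₀ hM', mul_comm]
  refine hc.trans (mul_le_mul_of_nonneg_left (le_trans (add_le_add ?_ ?_) hn) hM'.le)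
  · exact measureReal_mono fun ω hω => Nat.lt_ceil.1 hω
  · have h2 : (2 : ℝ) ^ ((n : ℝ) * (R - ε / 2)) ≤ 2 ^ k := by
      rw [← Real.rpow_natCast]
      exact Real.rpow_le_rpow_of_exponent_le one_le_two (Nat.le_ceil _)
    calc (M : ℝ) / 2 ^ k ≤ 2 * x / 2 ^ ((n : ℝ) * (R - ε / 2)) := by gcongr
      _ = 2 * ((2 : ℝ) ^ (-(ε / 2))) ^ n := by
        rw [hx, mul_div_assoc, ← Real.rpow_sub two_pos, ← Real.rpow_natCast,
          ← Real.rpow_mul two_pos.le]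
        ring_nf

/-! ### Levels received without interference -/

theorem link_apply {q : ℕ} (N : ℕ) (x : Word q) (i : Fin q) :
    link N x i = ∑ j : Fin q, if (i : ℕ) = j + (q - N) then x j else 0 := by
  simp [link, shiftMatrix, Matrix.mulVec, dotProduct]

theorem link_apply_of_eq {q N : ℕ} (x : Word q) {i j : Fin q} (h : (i : ℕ) = j + (q - N)) :
    link N x i = x j := by
  rw [link_apply, Finset.sum_eq_single j, if_pos h]
  · intro l _ hl
    refine if_neg fun h' => hl (Fin.ext ?_)
    omega
  · simp

theorem link_apply_eq_zero {q N : ℕ} {x : Word q} {i : Fin q}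
    (h : ∀ j : Fin q, (i : ℕ) = j + (q - N) → x j = 0) : link N x i = 0 := by
  rw [link_apply]
  refine Finset.sum_eq_zero fun j _ => ?_
  split_ifs with hj
  exacts [h j hj, rfl]

open Classical in
/-- The levels in `L` of transmitter 1 that reach receiver 1 in state `s = (N₁₁, N₂₁, N₂₂)`. As in
`link`, a state above `q` (a null event) acts as `q`. -/
noncomputable def directLevels {q : ℕ} (L : Set (Fin q)) (s : ℕ × ℕ × ℕ) : Finset (Fin q) :=
  Finset.univ.filter fun i => i ∈ L ∧ (i : ℕ) + (q - s.1) < q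

open Classical in
/-- The levels of transmitter 2 that reach receiver 2 in state `s = (N₁₁, N₂₁, N₂₂)` at an output
level to which no level in `L` of transmitter 1 is shifted. -/
noncomputable def cleanLevels {q : ℕ} (L : Set (Fin q)) (s : ℕ × ℕ × ℕ) : Finset (Fin q) :=
  Finset.univ.filter fun j => (j : ℕ) + (q - s.2.2) < q ∧
    ∀ i ∈ L, (i : ℕ) + (q - s.2.1) ≠ j + (q - s.2.2)

theorem eq_of_mem_directLevels {q : ℕ} {L : Set (Fin q)} {s : ℕ × ℕ × ℕ} {x x' : Word q}
    (h : link s.1 x = link s.1 x') {i : Fin q} (hi : i ∈ directLevels L s) : x i = x' i := by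
  simp only [directLevels, Finset.mem_filter, Finset.mem_univ, true_and] at hi
  have := congrFun h ⟨_, hi.2⟩
  rwa [link_apply_of_eq x (j := i) rfl, link_apply_of_eq x' (j := i) rfl] at this

/-- The bits of user 2 on the clean levels are determined by the output of receiver 2, even if the
input of user 1 is only known to be supported on `L`. -/
theorem eq_of_mem_cleanLevels {q : ℕ} {L : Set (Fin q)} {s : ℕ × ℕ × ℕ} {x x' u u' : Word q}
    (hx : ∀ i ∉ L, x i = 0) (hx' : ∀ i ∉ L, x' i = 0)
    (h : link s.2.1 x + link s.2.2 u = link s.2.1 x' + link s.2.2 u') {j : Fin q}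
    (hj : j ∈ cleanLevels L s) : u j = u' j := by
  simp only [cleanLevels, Finset.mem_filter, Finset.mem_univ, true_and] at hj
  have key : ∀ y : Word q, (∀ i ∉ L, y i = 0) → link s.2.1 y ⟨_, hj.1⟩ = 0 := fun y hy =>
    link_apply_eq_zero fun i hi => hy i fun hiL => hj.2 i hiL hi.symm
  have := congrFun h ⟨_, hj.1⟩
  rwa [Pi.add_apply, Pi.add_apply, key x hx, key x' hx', zero_add, zero_add,
    link_apply_of_eq u (j := j) rfl, link_apply_of_eq u' (j := j) rfl] at this

/-- Each level of `L` that interferes costs user 2 exactly one level. -/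
theorem card_cleanLevels {q : ℕ} (L : Set (Fin q)) {s : ℕ × ℕ × ℕ} (h1 : s.2.1 ≤ q)
    (h2 : s.2.2 ≤ q) :
    ((cleanLevels L s).card : ℝ) = s.2.2 - ∑ i : Fin q, L.indicator
      (fun i => if (i : ℕ) + 1 ≤ s.2.1 ∧ (s.2.1 : ℤ) - s.2.2 < ((i + 1 : ℕ) : ℤ)
        then (1 : ℝ) else 0) i := by
  classical
  obtain ⟨a, b, d⟩ := s
  simp only at h1 h2 ⊢
  set V : Finset (Fin q) := Finset.univ.filter fun j => (j : ℕ) < d with hV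
  set H : Finset (Fin q) := V.filter fun j => ∃ i ∈ L, (i : ℕ) + (q - b) = j + (q - d) with hH
  set G : Finset (Fin q) := Finset.univ.filter fun i =>
    i ∈ L ∧ (i : ℕ) + 1 ≤ b ∧ (b : ℤ) - d < ((i + 1 : ℕ) : ℤ) with hG
  have hVc : V.card = d := by
    rw [hV, Fin.card_filter_val_lt]; simp [h2]
  have hclean : cleanLevels L (a, b, d) = V.filter fun j : Fin q =>
      ¬ ∃ i ∈ L, (i : ℕ) + (q - b) = j + (q - d) := by
    ext j
    simp only [cleanLevels, hV, Finset.mem_filter, Finset.mem_univ, true_and, not_exists, not_and,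
      ne_eq]
    have : (j : ℕ) + (q - d) < q ↔ (j : ℕ) < d := by omega
    rw [this]
  have hHG : H.card = G.card := by
    symm
    -- Level `i` of user 1 and level `i + d - b` of user 2 meet at receiver 2.
    refine Finset.card_bij (fun i hi => ⟨(i : ℕ) + d - b, ?_⟩) ?_ ?_ ?_
    · simp only [hG, Finset.mem_filter] at hi; omega
    · intro i hi
      simp only [hG, hH, hV, Finset.mem_filter, Finset.mem_univ, true_and] at hi ⊢
      exact ⟨by omega, i, hi.1, by omega⟩
    · intro i hi i' hi' h
      simp only [hG, Finset.mem_filter, Fin.mk.injEq] at hi hi' h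
      exact Fin.ext (by omega)
    · intro j hj
      simp only [hH, hV, Finset.mem_filter, Finset.mem_univ, true_and] at hj
      obtain ⟨hjd, i, hiL, hij⟩ := hj
      refine ⟨i, ?_, Fin.ext ?_⟩
      · simp only [hG, Finset.mem_filter, Finset.mem_univ, true_and]
        exact ⟨hiL, by omega, by omega⟩
      · simp only; omega
  have hsum : ∑ i : Fin q, L.indicator
      (fun i => if (i : ℕ) + 1 ≤ b ∧ (b : ℤ) - d < ((i + 1 : ℕ) : ℤ) then (1 : ℝ) else 0) i
      = G.card := by
    rw [hG, ← Finset.sum_boole]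
    refine Finset.sum_congr rfl fun i _ => ?_
    by_cases hi : i ∈ L <;> simp [hi]
  rw [hsum, ← hHG, hclean, eq_sub_iff_add_eq]
  have := Finset.card_filter_add_card_filter_not (s := V)
    (fun j : Fin q => ∃ i ∈ L, (i : ℕ) + (q - b) = j + (q - d))
  rw [hVc] at this
  rw [add_comm]
  exact_mod_cast this

theorem card_directLevels {q : ℕ} (L : Set (Fin q)) {s : ℕ × ℕ × ℕ} (h : s.1 ≤ q) :
    ((directLevels L s).card : ℝ)
      = ∑ i : Fin q, L.indicator (fun i => if (i : ℕ) + 1 ≤ s.1 then (1 : ℝ) else 0) i := by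
  classical
  rw [directLevels, ← Finset.sum_boole]
  refine Finset.sum_congr rfl fun i _ => ?_
  have : (i : ℕ) + (q - s.1) < q ↔ (i : ℕ) + 1 ≤ s.1 := by omega
  by_cases hi : i ∈ L <;> simp [hi, this]

/-! ### Number of bits received in a block -/

namespace OneSidedIFC

variable {q : ℕ} {Ω : Type*} [MeasurableSpace Ω] {μ : Measure Ω}

/-- The triple `(N₁₁, N₂₁, N₂₂)` of the fading states in channel use `t`. -/
def state (ch : OneSidedIFC q μ) (t : ℕ) (ω : Ω) : ℕ × ℕ × ℕ :=
  (ch.N11 t ω, ch.N21 t ω, ch.N22 t ω)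

theorem measurable_state (ch : OneSidedIFC q μ) (t : ℕ) : Measurable (ch.state t) :=
  (ch.measurable_N11 t).prodMk ((ch.measurable_N21 t).prodMk (ch.measurable_N22 t))

open Classical in
/-- The positions received in a block of length `n`, where `g s` is the set of levels received in a
channel use with state `s`. -/
noncomputable def received (ch : OneSidedIFC q μ) (g : ℕ × ℕ × ℕ → Finset (Fin q)) (n : ℕ)
    (ω : Ω) : Finset (Fin n × Fin q) :=
  Finset.univ.filter fun p => p.2 ∈ g (ch.state p.1 ω)

theorem measurableSet_received (ch : OneSidedIFC q μ) (g : ℕ × ℕ × ℕ → Finset (Fin q)) (n : ℕ)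
    (a : Finset (Fin n × Fin q)) : MeasurableSet (ch.received g n ⁻¹' {a}) := by
  have hm : Measurable fun ω (t : Fin n) => ch.state t ω :=
    measurable_pi_lambda _ fun t => ch.measurable_state t
  exact hm (Set.to_countable
    {s : Fin n → ℕ × ℕ × ℕ | (Finset.univ.filter fun p : Fin n × Fin q => p.2 ∈ g (s p.1)) = a}
    ).measurableSet

theorem card_received (ch : OneSidedIFC q μ) (g : ℕ × ℕ × ℕ → Finset (Fin q)) (n : ℕ) (ω : Ω) :
    (ch.received g n ω).card = ∑ t ∈ Finset.range n, (g (ch.state t ω)).card := by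
  classical
  rw [received, Finset.card_filter, Fintype.sum_prod_type, ← Fin.sum_univ_eq_sum_range
    (fun t => (g (ch.state t ω)).card)]
  simp

theorem tendsto_card_received [IsProbabilityMeasure μ] (ch : OneSidedIFC q μ)
    (g : ℕ × ℕ × ℕ → Finset (Fin q)) {δ : ℝ} (hδ : 0 < δ) :
    Tendsto (fun n : ℕ => μ.real {ω | ((ch.received g n ω).card : ℝ)
      < n * ((∫ ω, ((g (ch.state 0 ω)).card : ℝ) ∂μ) - δ)}) atTop (nhds 0) := by
  have hm : Measurable fun ω t => ch.state t ω :=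
    measurable_pi_lambda _ ch.measurable_state
  set ν := μ.map fun ω t => ch.state t ω
  have : IsProbabilityMeasure ν := Measure.isProbabilityMeasure_map hm.aemeasurable
  set f : (ℕ → ℕ × ℕ × ℕ) → ℝ := fun s => ((g (s 0)).card : ℝ) with hf
  have hfm : Measurable f :=
    (measurable_of_countable (fun s : ℕ × ℕ × ℕ => ((g s).card : ℝ))).comp (measurable_pi_apply 0)
  have hf2 : MemLp f 2 ν := MemLp.of_bound hfm.aestronglyMeasurable q (.of_forall fun s => by
    rw [Real.norm_natCast]
    exact_mod_cast (Finset.card_le_univ _).trans_eq (Fintype.card_fin q))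
  have hconv := tendstoInMeasure_birkhoffAverage
    (show Ergodic (fun (s : ℕ → ℕ × ℕ × ℕ) (t : ℕ) => s (t + 1)) ν from ch.ergodic) hf2
  have hint : ∫ s, f s ∂ν = ∫ ω, ((g (ch.state 0 ω)).card : ℝ) ∂μ :=
    integral_map hm.aemeasurable hfm.aestronglyMeasurable
  rw [← hint]
  have h0 := (ENNReal.tendsto_toReal ENNReal.zero_ne_top).comp
    (hconv (ENNReal.ofReal δ) (by simpa using hδ))
  refine squeeze_zero (fun n => measureReal_nonneg) (fun n => ?_) h0
  refine ENNReal.toReal_mono (measure_ne_top _ _)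
    ((measure_mono fun ω hω => ?_).trans (Measure.le_map_apply hm.aemeasurable _))
  rw [Set.mem_ofPred_eq, card_received] at hω
  have hn : (0 : ℝ) < n := by
    rcases Nat.eq_zero_or_pos n with rfl | hn
    · simp at hω
    · exact_mod_cast hn
  have hiter : ∀ k (s : ℕ → ℕ × ℕ × ℕ), (fun (s : ℕ → ℕ × ℕ × ℕ) t => s (t + 1))^[k] s 0 = s k := by
    intro k
    induction k with
    | zero => exact fun s => rfl
    | succ k ih => exact fun s => by rw [Function.iterate_succ_apply, ih]
  have hsum : birkhoffAverage ℝ (fun (s : ℕ → ℕ × ℕ × ℕ) t => s (t + 1)) f n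
      (fun t => ch.state t ω)
        = (n : ℝ)⁻¹ * ∑ t ∈ Finset.range n, ((g (ch.state t ω)).card : ℝ) := by
    simp only [birkhoffAverage, birkhoffSum, hf, hiter, smul_eq_mul]
  rw [Set.mem_preimage, Set.mem_ofPred_eq]
  beta_reduce
  rw [hsum, edist_dist]
  refine ENNReal.ofReal_le_ofReal ?_
  rw [dist_comm, Real.dist_eq]
  refine le_trans ?_ (le_abs_self _)
  rw [Nat.cast_sum, ← inv_mul_lt_iff₀ hn] at hω
  linarith


/-! ### The code -/

open Classical in
/-- The block code of a pair of codebooks, the first masked to the levels in `L`. Receiver 1 looks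
for a message that explains its output; receiver 2 looks for a message that, together with some
input of user 1 supported on `L` (not necessarily a codeword), explains its output. -/
noncomputable def erasureCode {q n : ℕ} (L : Set (Fin q)) {M₁ M₂ : ℕ} (h₁ : 0 < M₁) (h₂ : 0 < M₂)
    (c₁ : Fin M₁ → Fin n × Fin q → ZMod 2) (c₂ : Fin M₂ → Fin n × Fin q → ZMod 2) : Code q n where
  M₁ := M₁
  M₂ := M₂
  enc₁ w t i := if i ∈ L then c₁ w (t, i) else 0
  enc₂ w t i := c₂ w (t, i)
  dec₁ y N :=
    if h : ∃ w, ∀ t, link (N t) (fun i => if i ∈ L then c₁ w (t, i) else 0) = y t then h.choose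
    else ⟨0, h₁⟩
  dec₂ y N N' :=
    if h : ∃ w, ∀ t, ∃ x : Word q, (∀ i ∉ L, x i = 0) ∧
      link (N t) x + link (N' t) (fun i => c₂ w (t, i)) = y t then h.choose
    else ⟨0, h₂⟩

theorem usesOnly₁_erasureCode {q n : ℕ} (L : Set (Fin q)) {M₁ M₂ : ℕ} (h₁ : 0 < M₁) (h₂ : 0 < M₂)
    (c₁ : Fin M₁ → Fin n × Fin q → ZMod 2) (c₂ : Fin M₂ → Fin n × Fin q → ZMod 2) :
    (erasureCode L h₁ h₂ c₁ c₂).UsesOnly₁ L :=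
  fun _ _ _ hi => if_neg hi

/-- A receiver decodes wrongly only if another codeword agrees with the one sent on all positions
that it receives without interference. -/
theorem errorEvent_erasureCode_subset (ch : OneSidedIFC q μ) {n : ℕ} (L : Set (Fin q)) {M₁ M₂ : ℕ}
    (h₁ : 0 < M₁) (h₂ : 0 < M₂)
    (c₁ : Fin M₁ → Fin n × Fin q → ZMod 2) (c₂ : Fin M₂ → Fin n × Fin q → ZMod 2)
    (w₁ : Fin M₁) (w₂ : Fin M₂) :
    ch.errorEvent (erasureCode L h₁ h₂ c₁ c₂) w₁ w₂ ⊆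
      {ω | ∃ w, w ≠ w₁ ∧ ∀ p ∈ ch.received (directLevels L) n ω, c₁ w₁ p = c₁ w p} ∪
      {ω | ∃ w, w ≠ w₂ ∧ ∀ p ∈ ch.received (cleanLevels L) n ω, c₂ w₂ p = c₂ w p} := by
  classical
  set C := erasureCode L h₁ h₂ c₁ c₂
  rintro ω (h | h)
  · left
    have hex : ∃ w, ∀ t : Fin n, link (ch.N11 t ω) (C.enc₁ w t) = ch.out₁ (C.enc₁ w₁) ω t :=
      ⟨w₁, fun t => rfl⟩
    have hdec : C.dec₁ (ch.out₁ (C.enc₁ w₁) ω) (fun t => ch.N11 t ω) = hex.choose := dif_pos hex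
    refine ⟨hex.choose, hdec ▸ h, fun p hp => ?_⟩
    have hp' : p.2 ∈ directLevels L (ch.state p.1 ω) := by simpa [received] using hp
    have hpL : p.2 ∈ L := by
      simp only [directLevels, Finset.mem_filter] at hp'
      exact hp'.2.1
    have := eq_of_mem_directLevels (s := ch.state p.1 ω) (hex.choose_spec p.1).symm hp'
    have henc : ∀ w, C.enc₁ w p.1 p.2 = c₁ w p := fun w => if_pos hpL
    exact (henc w₁).symm.trans (this.trans (henc _))
  · right
    have hex : ∃ w, ∀ t : Fin n, ∃ x : Word q, (∀ i ∉ L, x i = 0) ∧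
        link (ch.N21 t ω) x + link (ch.N22 t ω) (C.enc₂ w t)
          = ch.out₂ (C.enc₁ w₁) (C.enc₂ w₂) ω t :=
      ⟨w₂, fun t => ⟨C.enc₁ w₁ t, fun i hi => if_neg hi, rfl⟩⟩
    have hdec : C.dec₂ (ch.out₂ (C.enc₁ w₁) (C.enc₂ w₂) ω) (fun t => ch.N21 t ω)
        (fun t => ch.N22 t ω) = hex.choose := dif_pos hex
    refine ⟨hex.choose, hdec ▸ h, fun p hp => ?_⟩
    have hp' : p.2 ∈ cleanLevels L (ch.state p.1 ω) := by simpa [received] using hp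
    obtain ⟨x, hx, hxy⟩ := hex.choose_spec p.1
    exact eq_of_mem_cleanLevels (s := ch.state p.1 ω) (fun i hi => if_neg hi) hx hxy.symm hp'

theorem errorProb_erasureCode_le [IsProbabilityMeasure μ] (ch : OneSidedIFC q μ) {n : ℕ}
    (L : Set (Fin q)) {M₁ M₂ : ℕ} (h₁ : 0 < M₁) (h₂ : 0 < M₂)
    (c₁ : Fin M₁ → Fin n × Fin q → ZMod 2) (c₂ : Fin M₂ → Fin n × Fin q → ZMod 2) :
    ch.errorProb (erasureCode L h₁ h₂ c₁ c₂) ≤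
      (∑ w₁, μ.real {ω | ∃ w, w ≠ w₁ ∧ ∀ p ∈ ch.received (directLevels L) n ω,
        c₁ w₁ p = c₁ w p}) / M₁ +
      (∑ w₂, μ.real {ω | ∃ w, w ≠ w₂ ∧ ∀ p ∈ ch.received (cleanLevels L) n ω,
        c₂ w₂ p = c₂ w p}) / M₂ := by
  have h₁' : (0 : ℝ) < M₁ := by exact_mod_cast h₁
  have h₂' : (0 : ℝ) < M₂ := by exact_mod_cast h₂
  have hle : ∑ w₁ : Fin M₁, ∑ w₂ : Fin M₂,
      μ.real (ch.errorEvent (erasureCode L h₁ h₂ c₁ c₂) w₁ w₂) ≤ ∑ w₁ : Fin M₁, ∑ w₂ : Fin M₂,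
      (μ.real {ω | ∃ w, w ≠ w₁ ∧ ∀ p ∈ ch.received (directLevels L) n ω, c₁ w₁ p = c₁ w p} +
      μ.real {ω | ∃ w, w ≠ w₂ ∧ ∀ p ∈ ch.received (cleanLevels L) n ω, c₂ w₂ p = c₂ w p}) :=
    Finset.sum_le_sum fun w₁ _ => Finset.sum_le_sum fun w₂ _ =>
      (measureReal_mono (ch.errorEvent_erasureCode_subset L h₁ h₂ c₁ c₂ w₁ w₂)).trans
        (measureReal_union_le _ _)
  simp only [Finset.sum_add_distrib, Finset.sum_const, Finset.card_univ, Fintype.card_fin,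
    nsmul_eq_mul, ← Finset.mul_sum] at hle
  change (∑ w₁ : Fin M₁, ∑ w₂ : Fin M₂,
      μ.real (ch.errorEvent (erasureCode L h₁ h₂ c₁ c₂) w₁ w₂)) / ((M₁ : ℝ) * M₂) ≤ _
  rw [div_add_div _ _ h₁'.ne' h₂'.ne']
  gcongr
  linarith

/-- User 1 is restricted to an arbitrary set `L` of levels, and receiver 2 treats user 1 as
noise. -/
theorem achievableBy_usesOnly₁ [IsProbabilityMeasure μ] (ch : OneSidedIFC q μ) (L : Set (Fin q)) :
    ch.AchievableBy (fun _ => {C | C.UsesOnly₁ L})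
      (∫ ω, ((directLevels L (ch.state 0 ω)).card : ℝ) ∂μ)
      (∫ ω, ((cleanLevels L (ch.state 0 ω)).card : ℝ) ∂μ) := by
  refine ⟨integral_nonneg fun _ => Nat.cast_nonneg _, integral_nonneg fun _ => Nat.cast_nonneg _,
    fun ε hε => ?_⟩
  have key : ∀ g : ℕ × ℕ × ℕ → Finset (Fin q), _ := fun g =>
    eventually_exists_codebook_of_rate μ (fun n => ch.received g n)
      (fun n a => ch.measurableSet_received g n a) (fun δ hδ => ch.tendsto_card_received g hδ)
      (half_pos hε)
  have hmono : ∀ (n : ℕ) (R : ℝ), (2 : ℝ) ^ ((n : ℝ) * (R - ε)) ≤ 2 ^ ((n : ℝ) * (R - ε / 2)) :=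
    fun n R => Real.rpow_le_rpow_of_exponent_le one_le_two (by gcongr; linarith)
  filter_upwards [key (directLevels L), key (cleanLevels L)] with n ⟨M₁, h₁, hr₁, c₁, he₁⟩
    ⟨M₂, h₂, hr₂, c₂, he₂⟩
  refine ⟨erasureCode L h₁ h₂ c₁ c₂, usesOnly₁_erasureCode L h₁ h₂ c₁ c₂, (hmono n _).trans hr₁,
    (hmono n _).trans hr₂, (ch.errorProb_erasureCode_le L h₁ h₂ c₁ c₂).trans ?_⟩
  linarith

theorem AchievableBy.mono {ch : OneSidedIFC q μ} {F F' : ∀ n, Set (Code q n)} {R₁ R₂ : ℝ}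
    (h : ch.AchievableBy F R₁ R₂) (hF : ∀ n, F n ⊆ F' n) : ch.AchievableBy F' R₁ R₂ :=
  ⟨h.1, h.2.1, fun ε hε => (h.2.2 ε hε).mono fun n ⟨C, hC, hC'⟩ => ⟨C, hF n hC, hC'⟩⟩

/-! ### The rates -/

theorem integral_card_directLevels [IsProbabilityMeasure μ] (ch : OneSidedIFC q μ)
    (L : Set (Fin q)) :
    ∫ ω, ((directLevels L (ch.state 0 ω)).card : ℝ) ∂μ
      = ∑ i, L.indicator (fun i => ch.prDirect (i + 1)) i := by
  have hm : ∀ n, MeasurableSet {ω | n ≤ ch.N11 0 ω} := fun n =>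
    measurableSet_le measurable_const (ch.measurable_N11 0)
  have : ∀ᵐ ω ∂μ, ((directLevels L (ch.state 0 ω)).card : ℝ)
      = ∑ i : Fin q, L.indicator (fun i => {ω | (i : ℕ) + 1 ≤ ch.N11 0 ω}.indicator 1 ω) i := by
    filter_upwards [ch.N11_le 0] with ω hω
    simpa [Set.indicator_apply, state] using card_directLevels L (s := ch.state 0 ω) hω
  rw [integral_congr_ae this, integral_finsetSum]
  · refine Finset.sum_congr rfl fun i _ => ?_
    by_cases hi : i ∈ L
    · simp only [Set.indicator_of_mem hi, prDirect]
      exact integral_indicator_one (hm _)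
    · simp [hi]
  · intro i _
    by_cases hi : i ∈ L
    · simp only [Set.indicator_of_mem hi]
      exact (integrable_const 1).indicator (hm _)
    · simp [hi]

theorem integral_card_cleanLevels [IsProbabilityMeasure μ] (ch : OneSidedIFC q μ)
    (L : Set (Fin q)) :
    ∫ ω, ((cleanLevels L (ch.state 0 ω)).card : ℝ) ∂μ
      = ∫ ω, (ch.N22 0 ω : ℝ) ∂μ - ∑ i, L.indicator (fun i => ch.prInterfere (i + 1)) i := by
  have hm : ∀ n : ℕ, MeasurableSet {ω | n ≤ ch.N21 0 ω ∧ (ch.N21 0 ω : ℤ) - ch.N22 0 ω < n} :=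
    fun n => ch.measurable_state 0 (Set.to_countable
      {s : ℕ × ℕ × ℕ | n ≤ s.2.1 ∧ (s.2.1 : ℤ) - s.2.2 < n}).measurableSet
  have : ∀ᵐ ω ∂μ, ((cleanLevels L (ch.state 0 ω)).card : ℝ)
      = ch.N22 0 ω - ∑ i : Fin q, L.indicator (fun i => {ω | (i : ℕ) + 1 ≤ ch.N21 0 ω ∧
        (ch.N21 0 ω : ℤ) - ch.N22 0 ω < ((i + 1 : ℕ) : ℤ)}.indicator 1 ω) i := by
    filter_upwards [ch.N21_le 0, ch.N22_le 0] with ω h1 h2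
    simpa [Set.indicator_apply, state] using card_cleanLevels L (s := ch.state 0 ω) h1 h2
  have hi : ∀ i : Fin q, Integrable (fun ω => L.indicator (fun i => {ω | (i : ℕ) + 1 ≤ ch.N21 0 ω ∧
        (ch.N21 0 ω : ℤ) - ch.N22 0 ω < ((i + 1 : ℕ) : ℤ)}.indicator (1 : Ω → ℝ) ω) i) μ := by
    intro i
    by_cases hi : i ∈ L
    · simp only [Set.indicator_of_mem hi]
      exact (integrable_const 1).indicator (hm _)
    · simp [hi]
  rw [integral_congr_ae this, integral_sub, integral_finsetSum _ fun i _ => hi i]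
  · congr 1
    refine Finset.sum_congr rfl fun i _ => ?_
    by_cases hi : i ∈ L
    · simp only [Set.indicator_of_mem hi, prInterfere]
      exact integral_indicator_one (hm _)
    · simp [hi]
  · refine Integrable.of_bound
      ((measurable_of_countable _).comp (ch.measurable_N22 0)).aestronglyMeasurable q ?_
    filter_upwards [ch.N22_le 0] with ω hω
    rw [Real.norm_natCast]
    exact_mod_cast hω
  · exact integrable_finsetSum _ fun i _ => hi i

end OneSidedIFC

end LayeredErasure

theorem mainTheorem9 (q : ℕ) {Ω : Type*} [MeasurableSpace Ω] (μ : Measure Ω)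
    [IsProbabilityMeasure μ] (ch : LayeredErasure.OneSidedIFC q μ) :
    ∃ R₁ R₂ : ℝ,
      R₁ + R₂ = (∫ ω, (ch.N22 0 ω : ℝ) ∂μ)
        + ∑ n ∈ Finset.Icc 1 q, max (ch.prDirect n - ch.prInterfere n) 0 ∧
      ch.Achievable R₁ R₂ ∧
      ch.AchievableBy (fun _ => {C | C.UsesOnly₁ ch.goodLevels}) R₁ R₂ := by
  have h := ch.achievableBy_usesOnly₁ ch.goodLevels
  refine ⟨_, _, ?_, h.mono fun n => Set.subset_univ _, h⟩
  rw [ch.integral_card_directLevels, ch.integral_card_cleanLevels, add_sub_left_comm,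
    ← Finset.sum_sub_distrib, ← Finset.Ico_succ_right_eq_Icc, Finset.sum_Ico_eq_sum_range,
    ← Fin.sum_univ_eq_sum_range (fun n => max (ch.prDirect (1 + n) - ch.prInterfere (1 + n)) 0)]
  congr 1
  refine Finset.sum_congr rfl fun i _ => ?_
  rw [add_comm 1 (i : ℕ)]
  by_cases hi : i ∈ ch.goodLevels
  · rw [Set.indicator_of_mem hi, Set.indicator_of_mem hi, max_eq_left]
    exact sub_nonneg.2 (le_of_lt hi)
  · rw [Set.indicator_of_notMem hi, Set.indicator_of_notMem hi, sub_zero, max_eq_right]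
    exact sub_nonpos.2 (not_lt.1 hi)
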